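/- For an integer $n\ge 2$ let $G_n=\langle x,y : x^{4n}=y^2=1,\ yxy=x^{2n-1}\rangle = C_{4n}\rtimes_{2n-1}C_2$ be the generalized quasi-dihedral group of order $8n$. For a closed (compact, connected) Riemann surface $S$ let $\mathrm{Aut}(S)$ be its group of conformal and anticonformal automorphisms and $\mathrm{Aut}^+(S)$ its subgroup of conformal automorphisms; $S$ is called pseudo-real if it has anticonformal automorphisms but no anticonformal automorphism of order two. Let $n\ge 2$ be even. Then there is no pseudo-real Riemann surface $S$ such that $\mathrm{Aut}^+(S)$ has a subgroup $H\cong G_n$ and some $\alpha\in\mathrm{Aut}(S)\setminus\mathrm{Aut}^+(S)$ satisfies $\alpha H\alpha^{-1}=H$ and $\alpha^2\in H$ (equivalently, $H$ has index two in $\langle H,\alpha\rangle$). In particular, there is no pseudo-real Riemann surface $S$ with $\mathrm{Aut}^+(S)\cong G_n$. -/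

import Mathlib

open scoped Manifold ContDiff ComplexConjugate

namespace QuasiDihedral

/-- Multiplication by `2n - 1` on `ℤ/4n`, as an automorphism of the cyclic group `C_{4n}`;
it is its own inverse since `(2n - 1)² = 4n(n - 1) + 1`. -/
def twist (n : ℕ) : MulAut (Multiplicative (ZMod (4 * n))) :=
  have h : ∀ a : ZMod (4 * n), (2 * (n : ZMod (4 * n)) - 1) * ((2 * n - 1) * a) = a := by
    intro a
    have h4 : (4 : ZMod (4 * n)) * n = 0 := by
      have := ZMod.natCast_self (4 * n)
      push_cast at this
      exact this
    linear_combination (n - 1 : ZMod (4 * n)) * a * h4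
  AddEquiv.toMultiplicative
    { toFun := fun a => (2 * (n : ZMod (4 * n)) - 1) * a
      invFun := fun a => (2 * (n : ZMod (4 * n)) - 1) * a
      left_inv := h
      right_inv := h
      map_add' := fun a b => mul_add _ a b }

theorem twist_mul_twist (n : ℕ) : twist n * twist n = 1 := by
  ext a
  exact (twist n).symm_apply_apply a

/-- The action of `C₂` on `C_{4n}` in which the generator acts by `x ↦ x^{2n-1}`. -/
def action (n : ℕ) : Multiplicative (ZMod 2) →* MulAut (Multiplicative (ZMod (4 * n))) where
  toFun e := if e = 1 then 1 else twist n
  map_one' := by simp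
  map_mul' := by
    have key : ∀ a b : Multiplicative (ZMod 2),
        (a = 1 ∧ a * b = b) ∨ (b = 1 ∧ a * b = a) ∨ (a ≠ 1 ∧ b ≠ 1 ∧ a * b = 1) := by
      decide
    intro a b
    rcases key a b with ⟨h1, h2⟩ | ⟨h1, h2⟩ | ⟨h1, h2, h3⟩
    · rw [h2, if_pos h1, one_mul]
    · rw [h2, if_pos h1, mul_one]
    · rw [h3, if_pos rfl, if_neg h1, if_neg h2, twist_mul_twist]

/-- The generalized quasi-dihedral group of order `8n`,
`⟨x, y : x^{4n} = y² = 1, y x y = x^{2n-1}⟩ = C_{4n} ⋊_{2n-1} C₂`. -/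
abbrev G (n : ℕ) : Type :=
  Multiplicative (ZMod (4 * n)) ⋊[action n] Multiplicative (ZMod 2)

end QuasiDihedral

namespace RiemannSurface

universe u

variable {S : Type u} [TopologicalSpace S] [ChartedSpace ℂ S]

/-- The map `f` read in the preferred charts at `p` and `f p`. -/
noncomputable def localRep (f : S → S) (p : S) : ℂ → ℂ :=
  chartAt ℂ (f p) ∘ f ∘ (chartAt ℂ p).symm

/-- `f` is holomorphic: continuous, and complex differentiable when read in charts. -/
def IsHolomorphic (f : S → S) : Prop :=
  Continuous f ∧ ∀ p, DifferentiableAt ℂ (localRep f p) (chartAt ℂ p p)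

/-- `f` is antiholomorphic: continuous, and the complex conjugate of its expression in charts is
complex differentiable. -/
def IsAntiholomorphic (f : S → S) : Prop :=
  Continuous f ∧ ∀ p, DifferentiableAt ℂ (conj ∘ localRep f p) (chartAt ℂ p p)

/-- The notion of a holomorphic map used here is Mathlib's. -/
theorem isHolomorphic_iff_mdifferentiable (f : S → S) :
    IsHolomorphic f ↔ MDifferentiable 𝓘(ℂ) 𝓘(ℂ) f := by
  have h : ∀ p, MDifferentiableAt 𝓘(ℂ) 𝓘(ℂ) f p ↔
      ContinuousAt f p ∧ DifferentiableAt ℂ (localRep f p) (chartAt ℂ p p) := by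
    intro p
    rw [mdifferentiableAt_iff]
    simp [writtenInExtChartAt, localRep, extChartAt, differentiableWithinAt_univ]
  simp only [IsHolomorphic, MDifferentiable, h, forall_and, continuous_iff_continuousAt]

theorem localRep_apply_self (f : S → S) (p : S) :
    localRep f p (chartAt ℂ p p) = chartAt ℂ (f p) (f p) := by
  simp [localRep]

theorem localRep_comp (g : S → S) {f : S → S} (hf : Continuous f) (p : S) :
    localRep (g ∘ f) p =ᶠ[nhds (chartAt ℂ p p)] localRep g (f p) ∘ localRep f p := by
  have hc : ContinuousAt (f ∘ (chartAt ℂ p).symm) (chartAt ℂ p p) :=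
    hf.continuousAt.comp
      ((chartAt ℂ p).continuousAt_symm (mem_chart_target ℂ p))
  have hs : (chartAt ℂ (f p)).source ∈ nhds ((f ∘ (chartAt ℂ p).symm) (chartAt ℂ p p)) := by
    simpa using chart_source_mem_nhds ℂ (f p)
  filter_upwards [hc hs] with z hz
  have hz' : f ((chartAt ℂ p).symm z) ∈ (chartAt ℂ (f p)).source := hz
  simp [localRep, (chartAt ℂ (f p)).left_inv hz']

theorem localRep_id (p : S) : localRep (id : S → S) p =ᶠ[nhds (chartAt ℂ p p)] id := by
  filter_upwards [(chartAt ℂ p).open_target.mem_nhds (mem_chart_target ℂ p)] with z hz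
  simp [localRep, (chartAt ℂ p).right_inv hz]

theorem isHolomorphic_id : IsHolomorphic (id : S → S) :=
  ⟨continuous_id, fun p => differentiableAt_id.congr_of_eventuallyEq (localRep_id p)⟩

theorem IsHolomorphic.comp {g f : S → S} (hg : IsHolomorphic g) (hf : IsHolomorphic f) :
    IsHolomorphic (g ∘ f) := by
  refine ⟨hg.1.comp hf.1, fun p => ?_⟩
  refine DifferentiableAt.congr_of_eventuallyEq ?_ (localRep_comp g hf.1 p)
  refine DifferentiableAt.comp _ ?_ (hf.2 p)
  rw [localRep_apply_self]
  exact hg.2 (f p)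

theorem IsAntiholomorphic.comp_isHolomorphic {g f : S → S} (hg : IsAntiholomorphic g)
    (hf : IsHolomorphic f) : IsAntiholomorphic (g ∘ f) := by
  refine ⟨hg.1.comp hf.1, fun p => ?_⟩
  refine DifferentiableAt.congr_of_eventuallyEq ?_ ((localRep_comp g hf.1 p).fun_comp conj)
  refine DifferentiableAt.comp (g := conj ∘ localRep g (f p)) _ ?_ (hf.2 p)
  rw [localRep_apply_self]
  exact hg.2 (f p)

theorem IsHolomorphic.comp_isAntiholomorphic {g f : S → S} (hg : IsHolomorphic g)
    (hf : IsAntiholomorphic f) : IsAntiholomorphic (g ∘ f) := by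
  refine ⟨hg.1.comp hf.1, fun p => ?_⟩
  refine DifferentiableAt.congr_of_eventuallyEq ?_ ((localRep_comp g hf.1 p).fun_comp conj)
  have h1 : DifferentiableAt ℂ (conj ∘ localRep g (f p) ∘ conj)
      ((conj ∘ localRep f p) (chartAt ℂ p p)) := by
    simp only [Function.comp_apply, localRep_apply_self]
    exact (hg.2 (f p)).conj_conj
  have h2 := DifferentiableAt.comp _ h1 (hf.2 p)
  refine h2.congr_of_eventuallyEq (Filter.Eventually.of_forall fun z => ?_)
  simp

theorem IsAntiholomorphic.comp {g f : S → S} (hg : IsAntiholomorphic g)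
    (hf : IsAntiholomorphic f) : IsHolomorphic (g ∘ f) := by
  refine ⟨hg.1.comp hf.1, fun p => ?_⟩
  refine DifferentiableAt.congr_of_eventuallyEq ?_ (localRep_comp g hf.1 p)
  have h1 : DifferentiableAt ℂ (conj ∘ (conj ∘ localRep g (f p)) ∘ conj)
      ((conj ∘ localRep f p) (chartAt ℂ p p)) := by
    simp only [Function.comp_apply, localRep_apply_self]
    exact (hg.2 (f p)).conj_conj
  have h2 := DifferentiableAt.comp _ h1 (hf.2 p)
  refine h2.congr_of_eventuallyEq (Filter.Eventually.of_forall fun z => ?_)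
  simp

/-- A conformal automorphism: a biholomorphic self-map. -/
def IsConformal (f : S ≃ₜ S) : Prop := IsHolomorphic f ∧ IsHolomorphic f.symm

/-- An anticonformal automorphism: an antiholomorphic self-map with antiholomorphic inverse. -/
def IsAnticonformal (f : S ≃ₜ S) : Prop := IsAntiholomorphic f ∧ IsAntiholomorphic f.symm

variable (S)

/-- `Aut⁺(S)`, the group of conformal automorphisms of `S`. -/
def AutPlus : Subgroup (S ≃ₜ S) where
  carrier := {f | IsConformal f}
  one_mem' := ⟨isHolomorphic_id, isHolomorphic_id⟩
  mul_mem' := fun ha hb => ⟨ha.1.comp hb.1, hb.2.comp ha.2⟩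
  inv_mem' := fun ha => ⟨ha.2, ha.1⟩

/-- `Aut(S)`, the group of conformal and anticonformal automorphisms of `S`. -/
def Aut : Subgroup (S ≃ₜ S) where
  carrier := {f | IsConformal f ∨ IsAnticonformal f}
  one_mem' := Or.inl ⟨isHolomorphic_id, isHolomorphic_id⟩
  mul_mem' := by
    rintro a b (ha | ha) (hb | hb)
    · exact Or.inl ⟨ha.1.comp hb.1, hb.2.comp ha.2⟩
    · exact Or.inr ⟨ha.1.comp_isAntiholomorphic hb.1, hb.2.comp_isHolomorphic ha.2⟩
    · exact Or.inr ⟨ha.1.comp_isHolomorphic hb.1, hb.2.comp_isAntiholomorphic ha.2⟩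
    · exact Or.inl ⟨ha.1.comp hb.1, hb.2.comp ha.2⟩
  inv_mem' := by
    rintro a (ha | ha)
    · exact Or.inl ⟨ha.2, ha.1⟩
    · exact Or.inr ⟨ha.2, ha.1⟩

/-- `S` is pseudo-real: it has anticonformal automorphisms, but no anticonformal involution. -/
def IsPseudoReal : Prop :=
  (∃ f : S ≃ₜ S, IsAnticonformal f) ∧ ∀ f : S ≃ₜ S, IsAnticonformal f → orderOf f ≠ 2

end RiemannSurface

/-!
Suppose `α` normalizes `H ≅ G n` and `g := α²` lies in `H`, and let `σ` be the automorphism of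
`G n` induced by conjugation by `α`. Since `(hα)² = h · σ h · g`, an anticonformal involution in
`Hα` is a solution of `h · σ h · g = 1`. Automorphisms of `G n` have the form `x ↦ x^u`,
`y ↦ x^{2k} y`, and as `σ²` is conjugation by `g`, for `n` even `g` is a power `x^m` and
`2k(u + 1) ≡ (2 - 2n)m` modulo `4n`. Replacing `α` by `yα` replaces `u` by `(2n - 1)u ≡ -u` modulo
`4`, so we may assume `u ≡ 1` modulo `4`. Then `(u + 1)/2` is odd, which makes
`a(u + 1) + m ≡ 0` modulo `4n` solvable for `a`, and `h = x^a` is a solution.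
-/

namespace QuasiDihedral

section Generators

/-- The generator `x` of the cyclic subgroup of order `4n` in `G n`. -/
def x (n : ℕ) : G n := SemidirectProduct.inl (Multiplicative.ofAdd 1)

/-- The generator `y` of order two in `G n`, which acts on the powers of `x` by `x ↦ x^{2n-1}`. -/
def y (n : ℕ) : G n := SemidirectProduct.inr (Multiplicative.ofAdd 1)

variable {n : ℕ}

theorem x_zpow (i : ℤ) :
    x n ^ i = SemidirectProduct.inl (Multiplicative.ofAdd (i : ZMod (4 * n))) := by
  rw [x, ← map_zpow, ← ofAdd_zsmul, zsmul_one]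

theorem x_zpow_eq_x_zpow_iff {i j : ℤ} : x n ^ i = x n ^ j ↔ i ≡ j [ZMOD 4 * n] := by
  rw [x_zpow, x_zpow, SemidirectProduct.inl_inj, Multiplicative.ofAdd.injective.eq_iff,
    ZMod.intCast_eq_intCast_iff, Nat.cast_mul, Nat.cast_ofNat]

theorem x_zpow_eq_one_iff {i : ℤ} : x n ^ i = 1 ↔ i ≡ 0 [ZMOD 4 * n] := by
  rw [← zpow_zero (x n), x_zpow_eq_x_zpow_iff]

theorem y_mul_y (n : ℕ) : y n * y n = 1 := by
  rw [y, ← map_mul, ← map_one SemidirectProduct.inr]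
  congr 1

theorem y_conj_x (n : ℕ) : y n * x n * (y n)⁻¹ = x n ^ (2 * n - 1 : ℤ) := by
  rw [y, x, ← map_inv, ← SemidirectProduct.inl_aut, ← x, x_zpow]
  have action_ofAdd_one : action n (Multiplicative.ofAdd 1) = twist n :=
    if_neg (c := Multiplicative.ofAdd (1 : ZMod 2) = 1) (t := 1) (by decide)
  have twist_ofAdd_one : twist n (Multiplicative.ofAdd 1) =
      Multiplicative.ofAdd ((2 * (n : ZMod (4 * n)) - 1) * 1) := rfl
  rw [action_ofAdd_one, twist_ofAdd_one, mul_one]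
  push_cast
  rfl

theorem y_mul_x_zpow (n : ℕ) (i : ℤ) : y n * x n ^ i = x n ^ ((2 * n - 1) * i) * y n := by
  rw [zpow_mul, ← y_conj_x, conj_zpow, inv_mul_cancel_right]

theorem exists_eq_x_zpow_or (g : G n) : ∃ i : ℤ, g = x n ^ i ∨ g = x n ^ i * y n := by
  obtain ⟨i, hi⟩ := ZMod.intCast_surjective g.left.toAdd
  have hg : g = x n ^ i * SemidirectProduct.inr g.right := by
    rw [x_zpow, hi]
    exact (SemidirectProduct.inl_left_mul_inr_right g).symm
  have eq_one_or : ∀ c : Multiplicative (ZMod 2), c = 1 ∨ c = Multiplicative.ofAdd 1 := by decide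
  refine ⟨i, (eq_one_or g.right).imp (fun h => ?_) fun h => ?_⟩
  · rw [hg, h, map_one, mul_one]
  · rw [hg, h, y]

theorem x_zpow_mul_y_sq (n : ℕ) (i : ℤ) : (x n ^ i * y n) ^ 2 = x n ^ (2 * n * i) := by
  rw [sq, mul_assoc, ← mul_assoc (y n), y_mul_x_zpow, mul_assoc (x n ^ _), y_mul_y, mul_one,
    ← zpow_add]
  ring_nf

theorem not_commute_y_x (hn : n ≠ 1) : ¬ Commute (y n) (x n) := by
  intro h
  have hx : x n ^ (2 * n - 1 : ℤ) = x n ^ (1 : ℤ) := by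
    rw [← y_conj_x, h.eq, mul_inv_cancel_right, zpow_one]
  obtain ⟨q, hq⟩ := (x_zpow_eq_x_zpow_iff.1 hx).dvd
  have hdvd : (n : ℤ) ∣ 1 := ⟨2 * q + 1, by linarith⟩
  exact hn (by exact_mod_cast Int.eq_one_of_dvd_one n.cast_nonneg hdvd)

end Generators

section Automorphisms

variable {n : ℕ}

theorem exists_map_x_eq (hn : n ≠ 1) (σ : MulAut (G n)) : ∃ u : ℤ, σ (x n) = x n ^ u := by
  obtain ⟨u, hu | hu⟩ := exists_eq_x_zpow_or (σ (x n))
  · exact ⟨u, hu⟩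
  · have map_x_pow_four : σ (x n ^ 4) = 1 := by
      rw [map_pow, hu, pow_mul _ 2 2, x_zpow_mul_y_sq, ← zpow_natCast, ← zpow_mul,
        x_zpow_eq_one_iff, Int.modEq_zero_iff_dvd]
      exact ⟨u, by push_cast; ring⟩
    have hx : x n ^ (4 : ℤ) = 1 := (EmbeddingLike.map_eq_one_iff (f := σ)).1 map_x_pow_four
    obtain ⟨q, hq⟩ := Int.modEq_zero_iff_dvd.1 (x_zpow_eq_one_iff.1 hx)
    have hdvd : (n : ℤ) ∣ 1 := ⟨q, by linarith⟩
    exact absurd (by exact_mod_cast Int.eq_one_of_dvd_one n.cast_nonneg hdvd) hn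

theorem exists_map_y_eq (hn₀ : n ≠ 0) (hn₁ : n ≠ 1) (σ : MulAut (G n)) :
    ∃ k : ℤ, σ (y n) = x n ^ (2 * k) * y n := by
  obtain ⟨l, hl | hl⟩ := exists_eq_x_zpow_or (σ (y n))
  · obtain ⟨u, hu⟩ := exists_map_x_eq hn₁ σ
    have hcomm : Commute (σ (y n)) (σ (x n)) := by
      rw [hl, hu]
      exact Commute.zpow_zpow_self (x n) l u
    exact absurd (hcomm.of_map σ.injective) (not_commute_y_x hn₁)
  · have hx : x n ^ (2 * n * l) = 1 := by
      rw [← x_zpow_mul_y_sq, ← hl, sq, ← map_mul, y_mul_y, map_one]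
    obtain ⟨k, hk⟩ := Int.modEq_zero_iff_dvd.1 (x_zpow_eq_one_iff.1 hx)
    have hlk : l = 2 * k := mul_left_cancel₀ (show (2 * n : ℤ) ≠ 0 by lia) (by linarith)
    exact ⟨k, hlk ▸ hl⟩

theorem map_map_x_eq {σ : MulAut (G n)} {u : ℤ} (hu : σ (x n) = x n ^ u) :
    σ (σ (x n)) = x n ^ (u ^ 2) := by
  rw [hu, map_zpow, hu, ← zpow_mul, sq]

theorem exists_eq_x_zpow_of_mul_self_eq_conj (hn : Even n) {σ : MulAut (G n)} {g : G n}
    (hσ : σ * σ = MulAut.conj g) {u : ℤ} (hu : σ (x n) = x n ^ u) : ∃ m : ℤ, g = x n ^ m := by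
  obtain ⟨m, hm | hm⟩ := exists_eq_x_zpow_or g
  · exact ⟨m, hm⟩
  · exfalso
    have hx : x n ^ (u ^ 2) = x n ^ (2 * n - 1 : ℤ) := by
      rw [← map_map_x_eq hu, ← MulAut.mul_apply, hσ, MulAut.conj_apply, hm, mul_inv_rev,
        ← mul_assoc, mul_assoc (x n ^ m), mul_assoc (x n ^ m), y_conj_x, zpow_mul_comm,
        mul_inv_cancel_right]
    obtain ⟨N, hN⟩ := hn.natCast (α := ℤ)
    have hsq : u ^ 2 ≡ 3 [ZMOD 4] := by
      refine ((x_zpow_eq_x_zpow_iff.1 hx).of_mul_right _).trans (Int.modEq_iff_dvd.2 ⟨1 - N, ?_⟩)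
      rw [hN]
      ring
    rcases Int.even_or_odd u with ⟨v, rfl⟩ | hodd
    · obtain ⟨q, hq⟩ := hsq.dvd
      lia
    · rw [Int.ModEq, Int.sq_mod_four_eq_one_of_odd hodd] at hsq
      lia

theorem odd_of_mul_self_eq_conj {σ : MulAut (G n)} {m u : ℤ}
    (hσ : σ * σ = MulAut.conj (x n ^ m)) (hu : σ (x n) = x n ^ u) : Odd u := by
  have hx : x n ^ (u ^ 2) = x n ^ (1 : ℤ) := by
    rw [← map_map_x_eq hu, ← MulAut.mul_apply, hσ, MulAut.conj_apply, zpow_one,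
      (Commute.zpow_self (x n) m).eq, mul_inv_cancel_right]
  obtain ⟨q, hq⟩ := (x_zpow_eq_x_zpow_iff.1 hx).dvd
  refine (Int.odd_pow' two_ne_zero).1 ⟨-(2 * n * q), ?_⟩
  linarith

theorem modEq_of_mul_self_eq_conj {σ : MulAut (G n)} {m u k : ℤ}
    (hσ : σ * σ = MulAut.conj (x n ^ m)) (hu : σ (x n) = x n ^ u)
    (hk : σ (y n) = x n ^ (2 * k) * y n) :
    2 * k * (u + 1) ≡ (2 - 2 * n) * m [ZMOD 4 * n] := by
  rw [← x_zpow_eq_x_zpow_iff]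
  apply mul_right_cancel (b := y n)
  calc x n ^ (2 * k * (u + 1)) * y n
      = σ (σ (y n)) := by
        rw [hk, map_mul, map_zpow, hu, hk, ← zpow_mul, ← mul_assoc, ← zpow_add]
        ring_nf
    _ = x n ^ m * (y n * x n ^ (-m)) := by
        rw [← MulAut.mul_apply, hσ, MulAut.conj_apply, zpow_neg, mul_assoc]
    _ = x n ^ ((2 - 2 * n) * m) * y n := by
        rw [y_mul_x_zpow, ← mul_assoc, ← zpow_add]
        ring_nf

end Automorphisms

section Splitting

theorem exists_mul_add_modEq_zero {n u k m : ℤ} (hn : Even n) (hu : u ≡ 1 [ZMOD 4])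
    (h : 2 * k * (u + 1) ≡ (2 - 2 * n) * m [ZMOD 4 * n]) :
    ∃ a : ℤ, a * (u + 1) + m ≡ 0 [ZMOD 4 * n] := by
  obtain ⟨N, rfl⟩ := hn
  obtain ⟨w, hw⟩ := hu.symm.dvd
  obtain ⟨q, hq⟩ := h.symm.dvd
  -- `1 - n` is its own inverse modulo `2n`, so `h` determines `m` modulo `2n`.
  obtain ⟨e, he⟩ : ∃ e : ℤ, m = k * (u + 1) * (1 - (N + N)) + 2 * (N + N) * e := by
    refine ⟨-q * (1 - (N + N)) - (N - 1) * m, ?_⟩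
    have hhalf : k * (u + 1) - m * (1 - (N + N)) = 2 * (N + N) * q := by linarith
    linear_combination (-(1 - (N + N))) * hhalf
  refine ⟨-k * (1 - (N + N)) + (N + N) * e, Int.modEq_zero_iff_dvd.2 ⟨e * (w + 1), ?_⟩⟩
  obtain rfl : u = 4 * w + 1 := by linarith
  rw [he]
  ring

variable {n : ℕ}

theorem exists_mul_map_mul_eq_one_of_modEq_one (hn₀ : n ≠ 0) (hn : Even n) {σ : MulAut (G n)}
    {g : G n} (hσ : σ * σ = MulAut.conj g) {u : ℤ} (hu : σ (x n) = x n ^ u)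
    (hu4 : u ≡ 1 [ZMOD 4]) : ∃ h : G n, h * σ h * g = 1 := by
  obtain ⟨m, rfl⟩ := exists_eq_x_zpow_of_mul_self_eq_conj hn hσ hu
  obtain ⟨k, hk⟩ := exists_map_y_eq hn₀ (by rintro rfl; simp at hn) σ
  obtain ⟨a, ha⟩ :=
    exists_mul_add_modEq_zero hn.natCast hu4 (modEq_of_mul_self_eq_conj hσ hu hk)
  refine ⟨x n ^ a, ?_⟩
  calc x n ^ a * σ (x n ^ a) * x n ^ m
      = x n ^ (a * (u + 1) + m) := by
        rw [map_zpow, hu, ← zpow_mul, ← zpow_add, ← zpow_add]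
        ring_nf
    _ = 1 := x_zpow_eq_one_iff.2 ha

theorem conj_y_mul_map_x {σ : MulAut (G n)} {u : ℤ} (hu : σ (x n) = x n ^ u) :
    (MulAut.conj (y n) * σ) (x n) = x n ^ ((2 * n - 1) * u) := by
  rw [MulAut.mul_apply, hu, MulAut.conj_apply, y_mul_x_zpow, mul_inv_cancel_right]

theorem conj_mul_mul_conj_mul {K : Type*} [Group K] {σ : MulAut K} {g : K}
    (hσ : σ * σ = MulAut.conj g) (b : K) :
    (MulAut.conj b * σ) * (MulAut.conj b * σ) = MulAut.conj (b * σ b * g) := by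
  ext a
  have hσa : σ (σ a) = g * a * g⁻¹ := DFunLike.congr_fun hσ a
  simp only [MulAut.mul_apply, MulAut.conj_apply, map_mul, map_inv, hσa]
  group

theorem exists_mul_map_mul_eq_one (hn₀ : n ≠ 0) (hn : Even n) {σ : MulAut (G n)} {g : G n}
    (hσ : σ * σ = MulAut.conj g) : ∃ h : G n, h * σ h * g = 1 := by
  obtain ⟨u, hu⟩ := exists_map_x_eq (by rintro rfl; simp at hn) σ
  obtain ⟨m, rfl⟩ := exists_eq_x_zpow_of_mul_self_eq_conj hn hσ hu
  obtain ⟨N, hN⟩ := hn.natCast (α := ℤ)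
  obtain ⟨w, hw⟩ := odd_of_mul_self_eq_conj hσ hu
  rcases Int.even_or_odd' w with ⟨c, hc | hc⟩
  · exact exists_mul_map_mul_eq_one_of_modEq_one hn₀ hn hσ hu
      (Int.modEq_iff_dvd.2 ⟨-c, by lia⟩)
  · have hu' : (2 * n - 1) * u ≡ 1 [ZMOD 4] :=
      Int.modEq_iff_dvd.2 ⟨c + 1 - N * u, by rw [hN, hw, hc]; ring⟩
    obtain ⟨h, hh⟩ := exists_mul_map_mul_eq_one_of_modEq_one hn₀ hn
      (conj_mul_mul_conj_mul hσ (y n)) (conj_y_mul_map_x hu) hu'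
    refine ⟨h * y n, ?_⟩
    rw [← hh, map_mul, MulAut.mul_apply, MulAut.conj_apply]
    group

theorem exists_mem_mul_sq_eq_one_of_mulEquiv {Γ K : Type*} [Group Γ] [Group K]
    (hK : ∀ (σ : MulAut K) (g : K), σ * σ = MulAut.conj g → ∃ h : K, h * σ h * g = 1)
    {H : Subgroup Γ} (e : H ≃* K) {α : Γ} (hα : α ∈ Subgroup.normalizer (H : Set Γ))
    (hα2 : α ^ 2 ∈ H) : ∃ h ∈ H, (h * α) ^ 2 = 1 := by
  let τ : MulAut H := H.normalizerMonoidHom ⟨α, hα⟩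
  have coe_τ (h : H) : (τ h : Γ) = α * h * α⁻¹ := rfl
  have hτ : τ * τ = MulAut.conj ⟨α ^ 2, hα2⟩ := by
    ext h
    simp only [MulAut.mul_apply, coe_τ, MulAut.conj_apply, Subgroup.coe_mul, Subgroup.coe_inv,
      sq, mul_inv_rev, mul_assoc]
  have hσ : MulAut.congr e τ * MulAut.congr e τ = MulAut.conj (e ⟨α ^ 2, hα2⟩) := by
    rw [← map_mul, hτ]
    exact MulEquiv.ext fun h => by simp
  obtain ⟨h, hh⟩ := hK _ _ hσ
  have hH : e.symm h * τ (e.symm h) * ⟨α ^ 2, hα2⟩ = 1 := e.injective (by simpa using hh)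
  refine ⟨e.symm h, (e.symm h).2, ?_⟩
  calc ((e.symm h : Γ) * α) ^ 2 = e.symm h * (α * e.symm h * α⁻¹) * α ^ 2 := by
        simp only [sq, mul_assoc, inv_mul_cancel_left]
    _ = 1 := congrArg Subtype.val hH

theorem exists_mem_mul_sq_eq_one (hn₀ : n ≠ 0) (hn : Even n) {Γ : Type*} [Group Γ]
    {H : Subgroup Γ} (e : H ≃* G n) {α : Γ} (hα : α ∈ Subgroup.normalizer (H : Set Γ))
    (hα2 : α ^ 2 ∈ H) : ∃ h ∈ H, (h * α) ^ 2 = 1 :=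
  exists_mem_mul_sq_eq_one_of_mulEquiv (fun _ _ => exists_mul_map_mul_eq_one hn₀ hn) e hα hα2

end Splitting

end QuasiDihedral

namespace RiemannSurface

variable {S : Type*} [TopologicalSpace S] [ChartedSpace ℂ S]

theorem not_differentiableAt_conj (z : ℂ) : ¬ DifferentiableAt ℂ (conj : ℂ → ℂ) z := by
  rw [differentiableAt_complex_iff_differentiableAt_real]
  rintro ⟨-, cauchyRiemann⟩
  have hfderiv : fderiv ℝ (conj : ℂ → ℂ) z = Complex.conjCLE := Complex.conjCLE.fderiv
  simp [hfderiv, neg_eq_self] at cauchyRiemann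

theorem not_isAntiholomorphic_id [Nonempty S] : ¬ IsAntiholomorphic (id : S → S) := by
  rintro ⟨-, h⟩
  obtain ⟨p⟩ := ‹Nonempty S›
  exact not_differentiableAt_conj _
    ((h p).congr_of_eventuallyEq ((localRep_id p).fun_comp conj).symm)

namespace IsAnticonformal

variable {f g : S ≃ₜ S}

theorem inv (hf : IsAnticonformal f) : IsAnticonformal f⁻¹ :=
  ⟨hf.2, hf.1⟩

theorem notMem_autPlus [Nonempty S] (hf : IsAnticonformal f) : f ∉ AutPlus S := by
  intro hf'
  have hid : IsAntiholomorphic (f.symm ∘ f) := hf'.2.comp_isAntiholomorphic hf.1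
  rw [f.symm_comp_self] at hid
  exact not_isAntiholomorphic_id hid

theorem sq_mem_autPlus (hf : IsAnticonformal f) : f ^ 2 ∈ AutPlus S := by
  rw [sq]
  exact ⟨hf.1.comp hf.1, hf.2.comp hf.2⟩

theorem conj_mem_autPlus (hf : IsAnticonformal f) (hg : g ∈ AutPlus S) :
    f * g * f⁻¹ ∈ AutPlus S :=
  ⟨(hf.1.comp_isHolomorphic hg.1).comp hf.2, hf.1.comp (hg.2.comp_isAntiholomorphic hf.2)⟩

theorem mem_normalizer_autPlus (hf : IsAnticonformal f) :
    f ∈ Subgroup.normalizer (AutPlus S : Set (S ≃ₜ S)) := by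
  refine Subgroup.mem_normalizer_iff.2 fun g => ⟨hf.conj_mem_autPlus, fun hg => ?_⟩
  simpa [mul_assoc] using hf.inv.conj_mem_autPlus hg

end IsAnticonformal

theorem autPlus_le_aut : AutPlus S ≤ Aut S := fun _ => Or.inl

theorem IsPseudoReal.sq_ne_one (hS : IsPseudoReal S) {f : S ≃ₜ S} (hf : f ∈ Aut S)
    (hf' : f ∉ AutPlus S) : f ^ 2 ≠ 1 := fun hsq =>
  hS.2 f (hf.resolve_left hf')
    (orderOf_eq_prime hsq fun hone => hf' (hone ▸ one_mem _))

end RiemannSurface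

theorem theorem5p10_general (n : ℕ) (hn : 2 ≤ n) (hev : Even n)
    (S : Type*) [Nonempty S] [TopologicalSpace S] [ChartedSpace ℂ S]
    (hS : RiemannSurface.IsPseudoReal S) :
    (¬ ∃ H : Subgroup (S ≃ₜ S), H ≤ RiemannSurface.AutPlus S ∧
        Nonempty (H ≃* QuasiDihedral.G n) ∧
        ∃ α ∈ RiemannSurface.Aut S, α ∉ RiemannSurface.AutPlus S ∧
          α ∈ Subgroup.normalizer (H : Set (S ≃ₜ S)) ∧ α ^ 2 ∈ H) ∧
    ¬ Nonempty (RiemannSurface.AutPlus S ≃* QuasiDihedral.G n) := by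
  rw [and_iff_left_of_imp]
  · rintro ⟨H, hH, ⟨e⟩, α, hα, hα', hnorm, hsq⟩
    obtain ⟨h, hh, hone⟩ :=
      QuasiDihedral.exists_mem_mul_sq_eq_one (by lia) hev e hnorm hsq
    exact hS.sq_ne_one (mul_mem (RiemannSurface.autPlus_le_aut (hH hh)) hα)
      (fun hmem => hα' ((Subgroup.mul_mem_cancel_left _ (hH hh)).1 hmem)) hone
  · rintro not_exists ⟨e⟩
    obtain ⟨f, hf⟩ := hS.1
    exact not_exists ⟨_, le_rfl, ⟨e⟩, f, Or.inr hf, hf.notMem_autPlus,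
      hf.mem_normalizer_autPlus, hf.sq_mem_autPlus⟩

theorem theorem5p10 (n : ℕ) (hn : 2 ≤ n) (hev : Even n)
    (S : Type*) [TopologicalSpace S] [T2Space S] [CompactSpace S] [ConnectedSpace S]
    [ChartedSpace ℂ S] [IsManifold 𝓘(ℂ) ω S] (hS : RiemannSurface.IsPseudoReal S) :
    (¬ ∃ H : Subgroup (S ≃ₜ S), H ≤ RiemannSurface.AutPlus S ∧
        Nonempty (H ≃* QuasiDihedral.G n) ∧
        ∃ α ∈ RiemannSurface.Aut S, α ∉ RiemannSurface.AutPlus S ∧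
          α ∈ Subgroup.normalizer (H : Set (S ≃ₜ S)) ∧ α ^ 2 ∈ H) ∧
    ¬ Nonempty (RiemannSurface.AutPlus S ≃* QuasiDihedral.G n) :=
  theorem5p10_general n hn hev S hS
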